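/- Let $d\ge 2$ and $r\ge 1$ be integers, and let $\phi=[\phi_1,\dots,\phi_r]^T:\mathbb{R}\to\mathbb{K}^r$ ($\mathbb{K}=\mathbb{R}$ or $\mathbb{C}$) be a two-direction multiscaling function of multiplicity $r$ and dilation factor $d$. This means that there are real $r\times r$ matrices $P_k^+,P_k^-$ ($k\in\mathbb{Z}$) with $$\phi(x)=\sqrt d\sum_{k\in\mathbb{Z}}\bigl[P_k^+\phi(dx-k)+P_k^-\phi(k-dx)\bigr]\qquad(x\in\mathbb{R}),$$ and that $\phi$ generates a multiresolution approximation of $L^2(\mathbb{R})$: the closed linear spans $V_n$ ($n\in\mathbb{Z}$) in $L^2(\mathbb{R})$ of the functions $\phi_i(d^nx-k)$, $\phi_i(k-d^nx)$ ($1\le i\le r$, $k\in\mathbb{Z}$) are nested ($V_n\subset V_{n+1}$), have dense union and intersection $\{0\}$, satisfy $f\in V_n\iff f(d\,\cdot)\in V_{n+1}$ and $f\in V_n\iff f(\cdot-d^{-n}k)\in V_n$ for all $k\in\mathbb{Z}$, and the functions $\phi_i(x-k)$, $\phi_i(k-x)$ form a Riesz basis of $V_0$. Assume that $\phi$ is continuous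 and compactly supported; that $\phi$ is orthogonal, i.e. for all $j,k\in\mathbb{Z}$ $$\int_{\mathbb{R}}\phi(x-j)\,\phi(x-k)^*\,dx=\delta_{jk}I_r,\qquad \int_{\mathbb{R}}\phi(x-j)\,\phi(k-x)^*\,dx=O;$$ and that $\phi$ satisfies Condition E: the matrix $$\frac1{\sqrt d}\sum_{k\in\mathbb{Z}}\begin{bmatrix}P_k^+&P_k^-\\P_{-k}^-&P_{-k}^+\end{bmatrix}$$ has $1$ as a simple eigenvalue, and all its other (complex) eigenvalues are smaller than $1$ in absolute value. Then the zeroth continuous moment $\mathbf m_0=\int_{-\infty}^{\infty}\phi(x)\,dx\in\mathbb{K}^r$ satisfies $$\mathbf m_0^*\,\mathbf m_0=\frac12 .$$ -/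

import Mathlib

open MeasureTheory Matrix

namespace TwoDirection

/-- The matrix-valued inner product `⟨f, g⟩ = ∫ f(x) g(x)^* dx` of two vector-valued functions. -/
noncomputable def innerMatrix {𝕜 : Type*} [RCLike 𝕜] {r : ℕ} (f g : ℝ → Fin r → 𝕜) :
    Matrix (Fin r) (Fin r) 𝕜 :=
  Matrix.of fun i j => ∫ x : ℝ, f x i * star (g x j)

/-- Orthogonality of `φ`: for all integers `j`, `k`,
`⟨φ(x - j), φ(x - k)⟩ = δ_{jk} I_r` and `⟨φ(x - j), φ(k - x)⟩ = O`. -/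
structure IsOrthogonal {𝕜 : Type*} [RCLike 𝕜] {r : ℕ} (φ : ℝ → Fin r → 𝕜) : Prop where
  same : ∀ j k : ℤ,
    innerMatrix (fun x => φ (x - j)) (fun x => φ (x - k)) = if j = k then 1 else 0
  cross : ∀ j k : ℤ,
    innerMatrix (fun x => φ (x - j)) (fun x => φ (k - x)) = 0

/-- The scalar functions `φ_i(d^n x - k)` (left summand) and `φ_i(k - d^n x)` (right summand). -/
noncomputable def dilates {𝕜 : Type*} {r : ℕ} (d : ℕ) (φ : ℝ → Fin r → 𝕜) (n : ℤ) :
    (ℤ × Fin r) ⊕ (ℤ × Fin r) → ℝ → 𝕜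
  | Sum.inl (k, i) => fun x => φ ((d : ℝ) ^ n * x - k) i
  | Sum.inr (k, i) => fun x => φ (k - (d : ℝ) ^ n * x) i

/-- The subspace `V_n` of `L²(ℝ)`: the closed linear span of all the functions
`φ_i(d^n x - k)` and `φ_i(k - d^n x)`, `k ∈ ℤ`. -/
noncomputable def scalingSpace {𝕜 : Type*} [RCLike 𝕜] {r : ℕ} (d : ℕ) (φ : ℝ → Fin r → 𝕜)
    (n : ℤ) : Submodule 𝕜 (Lp 𝕜 2 (volume : Measure ℝ)) :=
  (Submodule.span 𝕜
    {f : Lp 𝕜 2 (volume : Measure ℝ) | ∃ e, f =ᵐ[volume] dilates d φ n e}).topologicalClosure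

/-- A multiresolution approximation of `L²(ℝ)` with dilation factor `d`: nested closed subspaces
with dense union and trivial intersection, compatible with dilations and translations. -/
structure IsMultiresolution {𝕜 : Type*} [RCLike 𝕜] (d : ℕ)
    (V : ℤ → Submodule 𝕜 (Lp 𝕜 2 (volume : Measure ℝ))) : Prop where
  closed : ∀ n, IsClosed (V n : Set (Lp 𝕜 2 (volume : Measure ℝ)))
  nested : ∀ n, V n ≤ V (n + 1)
  dense : Dense (⋃ n, (V n : Set (Lp 𝕜 2 (volume : Measure ℝ))))
  trivial_inter : ⨅ n, V n = ⊥
  dilation : ∀ (n : ℤ) (f g : Lp 𝕜 2 (volume : Measure ℝ)),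
    g =ᵐ[volume] (fun x => f ((d : ℝ) * x)) → (f ∈ V n ↔ g ∈ V (n + 1))
  translation : ∀ (n k : ℤ) (f g : Lp 𝕜 2 (volume : Measure ℝ)),
    g =ᵐ[volume] (fun x => f (x - (d : ℝ) ^ (-n) * k)) → (f ∈ V n ↔ g ∈ V n)

/-- `L²`-stability: the functions `φ_i(x - k)`, `φ_i(k - x)` form a Riesz sequence. -/
def IsStable {𝕜 : Type*} [RCLike 𝕜] {r : ℕ} (d : ℕ) (φ : ℝ → Fin r → 𝕜) : Prop :=
  ∃ A B : ℝ, 0 < A ∧ 0 < B ∧ ∀ c : ((ℤ × Fin r) ⊕ (ℤ × Fin r)) →₀ 𝕜,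
    A * (∑ e ∈ c.support, ‖c e‖ ^ 2)
        ≤ ∫ x : ℝ, ‖∑ e ∈ c.support, c e * dilates d φ 0 e x‖ ^ 2 ∧
      ∫ x : ℝ, ‖∑ e ∈ c.support, c e * dilates d φ 0 e x‖ ^ 2
        ≤ B * (∑ e ∈ c.support, ‖c e‖ ^ 2)

/-- `φ` is a two-direction multiscaling function of multiplicity `r` and dilation factor `d` with
real recursion coefficients `P_k^+ = Pp k`, `P_k^- = Pm k`: it satisfies
`φ(x) = √d ∑_k [P_k^+ φ(dx - k) + P_k^- φ(k - dx)]`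
and generates a multiresolution approximation of `L²(ℝ)`, that is, the spaces `V_n` spanned by it
form a multiresolution approximation and `φ_i(x - k)`, `φ_i(k - x)` are a Riesz basis of `V_0`.
(For compactly supported `φ` all but finitely many terms of the series vanish at each `x`.) -/
structure IsMultiscaling {𝕜 : Type*} [RCLike 𝕜] {r : ℕ} (d : ℕ)
    (Pp Pm : ℤ → Matrix (Fin r) (Fin r) ℝ) (φ : ℝ → Fin r → 𝕜) : Prop where
  two_le : 2 ≤ d
  refinement : ∀ x : ℝ, HasSum
    (fun k : ℤ => (Real.sqrt d : 𝕜) •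
      ((Pp k).map (algebraMap ℝ 𝕜) *ᵥ φ ((d : ℝ) * x - k)
        + (Pm k).map (algebraMap ℝ 𝕜) *ᵥ φ (k - (d : ℝ) * x))) (φ x)
  multiresolution : IsMultiresolution d (scalingSpace d φ)
  stable : IsStable d φ

/-- Condition E for a complex matrix: `1` is a simple eigenvalue (a simple root of the
characteristic polynomial), and all other eigenvalues are smaller than `1` in absolute value. -/
def ConditionE {m : Type*} [Fintype m] [DecidableEq m] (A : Matrix m m ℂ) : Prop :=
  A.charpoly.rootMultiplicity 1 = 1 ∧
    ∀ μ : ℂ, Module.End.HasEigenvalue (Matrix.toLin' A) μ → μ ≠ 1 → ‖μ‖ < 1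

/-- The matrix `d^{-1/2} ∑_k [P_k^+, P_k^-; P_{-k}^-, P_{-k}^+]`. (If `φ` is orthogonal and
compactly supported, only finitely many of its recursion coefficients are nonzero.) -/
noncomputable def symbolAtOne {r : ℕ} (d : ℕ) (Pp Pm : ℤ → Matrix (Fin r) (Fin r) ℝ) :
    Matrix (Fin r ⊕ Fin r) (Fin r ⊕ Fin r) ℝ :=
  (Real.sqrt d)⁻¹ • ∑' k : ℤ, Matrix.fromBlocks (Pp k) (Pm k) (Pm (-k)) (Pp (-k))

/-- The `j`-th continuous moment `m_j = ∫ x^j φ(x) dx`, a vector of size `r`. -/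
noncomputable def moment {𝕜 : Type*} [RCLike 𝕜] {r : ℕ} (φ : ℝ → Fin r → 𝕜) (j : ℕ) :
    Fin r → 𝕜 :=
  fun i => ∫ x : ℝ, ((x ^ j : ℝ) : 𝕜) * φ x i

end TwoDirection

/-!
Test the spaces `V_n` on the indicator function `f` of `(0, 1]`. They increase to a dense subspace,
so the projections `P_n f` satisfy `‖P_n f‖² → ‖f‖² = 1`. Write `N = dⁿ` and let `ψ_a` run over the
components of `φ(x)` and of `φ(-x)`. The functions `√N ψ_a(N x - k)` are an orthonormal basis of
`V_n`, and Parseval's identity reads `‖P_n f‖² = ∑_a N⁻¹ ∑_k |∫_{(-k, N - k]} ψ_a|²`.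

Expanding the squares as double integrals, `N⁻¹ ∑_k |∫_{(-k, N - k]} ψ|²` is the integral of
`N⁻¹ c_N(x, y) ψ(x) conj(ψ(y))`, where `c_N(x, y)` counts the windows `(-k, N - k]` containing both
`x` and `y`. Since `c_N(x, y)` differs from `N` by at most `|x - y| + 1` and never exceeds `N + 1`,
dominated convergence gives the limit `|∫ ψ|²`. Hence `∑_a |∫ ψ_a|² = 1`, and each component of the
zeroth moment occurs twice in this sum, once for `φ(x)` and once for `φ(-x)`.
-/

namespace TwoDirection

open Filter Topology ComplexConjugate

section Parseval

variable {𝕜 E ι : Type*} [RCLike 𝕜] [NormedAddCommGroup E] [InnerProductSpace 𝕜 E]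

theorem hasSum_norm_inner_sq_starProjection {v : ι → E} (hv : Orthonormal 𝕜 v) (f : E)
    [CompleteSpace (Submodule.span 𝕜 (Set.range v)).topologicalClosure] :
    HasSum (fun i => ‖inner 𝕜 (v i) f‖ ^ 2)
      (‖(Submodule.span 𝕜 (Set.range v)).topologicalClosure.starProjection f‖ ^ 2) := by
  set K := (Submodule.span 𝕜 (Set.range v)).topologicalClosure
  let u (i : ι) : K := ⟨v i, Submodule.le_topologicalClosure _ (Submodule.subset_span ⟨i, rfl⟩)⟩
  have hbot : (Submodule.span 𝕜 (Set.range u))ᗮ = ⊥ := by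
    refine (Submodule.eq_bot_iff _).2 fun x hx => ?_
    have hxv : Submodule.span 𝕜 (Set.range v) ⟂ Submodule.span 𝕜 {(x : E)} := by
      rw [Submodule.isOrtho_span]
      rintro _ ⟨i, rfl⟩ _ rfl
      exact hx (u i) (Submodule.subset_span ⟨i, rfl⟩)
    have hxK : (x : E) ∈ Kᗮ := by
      rw [Submodule.orthogonal_closure]
      exact hxv.symm.le (Submodule.mem_span_singleton_self _)
    exact Subtype.ext (inner_self_eq_zero.1 (hxK x x.2))
  let b := HilbertBasis.mkOfOrthogonalEqBot (v := u) (hv.codRestrict K _) hbot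
  have hb (i : ι) : inner 𝕜 (b i) (K.orthogonalProjectionOnto f) = inner 𝕜 (v i) f := by
    rw [show ⇑b = u from HilbertBasis.coe_mkOfOrthogonalEqBot _ hbot]
    exact Submodule.inner_orthogonalProjectionOnto_eq_of_mem_left _ f
  have hsum := b.hasSum_inner_mul_inner (K.orthogonalProjectionOnto f)
    (K.orthogonalProjectionOnto f)
  simp only [← inner_conj_symm (K.orthogonalProjectionOnto f) (b _), hb, RCLike.conj_mul,
    inner_self_eq_norm_sq_to_K] at hsum
  exact_mod_cast hsum

theorem tendsto_tsum_norm_inner_sq [CompleteSpace E] {κ : Type*} [Preorder κ] {v : κ → ι → E}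
    (hv : ∀ n, Orthonormal 𝕜 (v n))
    (hmono : Monotone fun n => (Submodule.span 𝕜 (Set.range (v n))).topologicalClosure)
    (hdense : ⊤ ≤
      (⨆ n, (Submodule.span 𝕜 (Set.range (v n))).topologicalClosure).topologicalClosure)
    (f : E) :
    Tendsto (fun n => ∑' i, ‖inner 𝕜 (v n i) f‖ ^ 2) atTop (𝓝 (‖f‖ ^ 2)) := by
  simp only [fun n => (hasSum_norm_inner_sq_starProjection (hv n) f).tsum_eq]
  exact (Submodule.starProjection_tendsto_self _ hmono f hdense).norm.pow 2

end Parseval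

section Windows

/-- The interval `(-k, N - k]`, the image of `(0, 1]` under `x ↦ N x - k`. -/
def window (N : ℝ) (k : ℤ) : Set ℝ :=
  Set.Ioc (-k) (N - k)

/-- The indices `k` of the windows `(-k, N - k]` that contain both coordinates of `z`. -/
noncomputable def sharedWindows (N : ℝ) (z : ℝ × ℝ) : Finset ℤ :=
  Finset.Ioc ⌊-min z.1 z.2⌋ ⌊N - max z.1 z.2⌋

theorem measurableSet_window_prod (N : ℝ) (k : ℤ) :
    MeasurableSet (window N k ×ˢ window N k) :=
  measurableSet_Ioc.prod measurableSet_Ioc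

theorem mem_sharedWindows {N : ℝ} {z : ℝ × ℝ} {k : ℤ} :
    k ∈ sharedWindows N z ↔ z ∈ window N k ×ˢ window N k := by
  simp only [sharedWindows, window, Finset.mem_Ioc, Set.mem_prod, Set.mem_Ioc, Int.floor_lt,
    Int.le_floor]
  rw [neg_lt, lt_min_iff, le_sub_comm, max_le_iff]
  tauto

theorem card_sharedWindows (N : ℝ) (z : ℝ × ℝ) :
    (sharedWindows N z).card = (⌊N - max z.1 z.2⌋ - ⌊-min z.1 z.2⌋).toNat :=
  Int.card_Ioc _ _

theorem measurable_card_sharedWindows (N : ℝ) :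
    Measurable fun z => ((sharedWindows N z).card : ℝ) := by
  simp only [card_sharedWindows]
  have : Measurable fun z : ℝ × ℝ => ⌊N - max z.1 z.2⌋ - ⌊-min z.1 z.2⌋ := by fun_prop
  exact (measurable_from_top (f := fun m : ℤ => (m.toNat : ℝ))).comp this

theorem sub_abs_sub_one_le_card_sharedWindows (N : ℝ) (z : ℝ × ℝ) :
    N - |z.1 - z.2| - 1 ≤ (sharedWindows N z).card := by
  have h := Int.self_le_toNat (⌊N - max z.1 z.2⌋ - ⌊-min z.1 z.2⌋)
  have h' : ((⌊N - max z.1 z.2⌋ : ℝ) - ⌊-min z.1 z.2⌋) ≤ (sharedWindows N z).card := by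
    rw [card_sharedWindows]
    exact_mod_cast h
  linarith [Int.lt_floor_add_one (N - max z.1 z.2), Int.floor_le (-min z.1 z.2),
    max_sub_min_eq_abs' z.1 z.2]

theorem card_sharedWindows_le {N : ℝ} (hN : 0 ≤ N) (z : ℝ × ℝ) :
    ((sharedWindows N z).card : ℝ) ≤ N + 1 := by
  rw [card_sharedWindows, ← Int.cast_natCast, Int.toNat_eq_max, Int.cast_max, Int.cast_zero,
    Int.cast_sub, max_le_iff]
  constructor <;> linarith [Int.floor_le (N - max z.1 z.2), Int.lt_floor_add_one (-min z.1 z.2),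
    min_le_max (a := z.1) (b := z.2)]

variable {E : Type*} [NormedAddCommGroup E] [NormedSpace ℝ E] {g : ℝ × ℝ → E}

theorem hasSum_indicator_window_prod (N : ℝ) (g : ℝ × ℝ → E) (z : ℝ × ℝ) :
    HasSum (fun k : ℤ => (window N k ×ˢ window N k).indicator g z)
      (((sharedWindows N z).card : ℝ) • g z) := by
  have hsum : ∑ k ∈ sharedWindows N z, (window N k ×ˢ window N k).indicator g z
      = ((sharedWindows N z).card : ℝ) • g z := by
    rw [Finset.sum_congr rfl fun k hk => Set.indicator_of_mem (mem_sharedWindows.1 hk) g,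
      Finset.sum_const, Nat.cast_smul_eq_nsmul]
  rw [← hsum]
  exact hasSum_sum_of_ne_finset_zero fun k hk =>
    Set.indicator_of_notMem (mem_sharedWindows.not.1 hk) g

theorem hasSum_setIntegral_window_prod (hg : Integrable g) {N : ℝ} (hN : 0 ≤ N) :
    HasSum (fun k : ℤ => ∫ z in window N k ×ˢ window N k, g z)
      (∫ z, ((sharedWindows N z).card : ℝ) • g z) := by
  simp only [← integral_indicator (measurableSet_window_prod N _)]
  refine hasSum_integral_of_dominated_convergence
    (fun k z => (window N k ×ˢ window N k).indicator (fun z => ‖g z‖) z)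
    (fun k => hg.aestronglyMeasurable.indicator (measurableSet_window_prod N k))
    (fun k => ae_of_all _ fun z => (norm_indicator_eq_indicator_norm g z).le)
    (ae_of_all _ fun z => (hasSum_indicator_window_prod N _ z).summable) ?_
    (ae_of_all _ (hasSum_indicator_window_prod N g))
  simp only [(hasSum_indicator_window_prod N _ _).tsum_eq]
  exact hg.norm.bdd_smul (N + 1) (measurable_card_sharedWindows N).aestronglyMeasurable
    (ae_of_all _ fun z => (RCLike.norm_natCast _).trans_le (card_sharedWindows_le hN z))

theorem tendsto_inv_mul_card_sharedWindows (z : ℝ × ℝ) :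
    Tendsto (fun N => N⁻¹ * ((sharedWindows N z).card : ℝ)) atTop (𝓝 1) := by
  have hlim (c : ℝ) : Tendsto (fun N : ℝ => N⁻¹ * (N + c)) atTop (𝓝 1) := by
    have h : Tendsto (fun N : ℝ => 1 + N⁻¹ * c) atTop (𝓝 1) := by
      simpa using (tendsto_inv_atTop_zero.mul_const c).const_add 1
    refine h.congr' ?_
    filter_upwards [eventually_ne_atTop 0] with N hN
    rw [mul_add, inv_mul_cancel₀ hN]
  refine tendsto_of_tendsto_of_tendsto_of_le_of_le' (hlim (-|z.1 - z.2| - 1)) (hlim 1) ?_ ?_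
  all_goals
    filter_upwards [eventually_ge_atTop 0] with N hN
    gcongr
  · linarith [sub_abs_sub_one_le_card_sharedWindows N z]
  · exact card_sharedWindows_le hN z

theorem tendsto_inv_smul_tsum_setIntegral_window_prod (hg : Integrable g) :
    Tendsto (fun N : ℝ => N⁻¹ • ∑' k : ℤ, ∫ z in window N k ×ˢ window N k, g z) atTop
      (𝓝 (∫ z, g z)) := by
  have hlim : Tendsto
      (fun N : ℝ => ∫ z, (N⁻¹ * ((sharedWindows N z).card : ℝ)) • g z) atTop (𝓝 (∫ z, g z)) := by
    refine tendsto_integral_filter_of_dominated_convergence (fun z => 2 * ‖g z‖)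
      (Eventually.of_forall fun N => ?_) ?_ (hg.norm.const_mul 2) (ae_of_all _ fun z => ?_)
    · exact ((measurable_card_sharedWindows N).const_mul N⁻¹).aestronglyMeasurable.smul
        hg.aestronglyMeasurable
    · filter_upwards [eventually_ge_atTop 1] with N hN
      refine ae_of_all _ fun z => ?_
      rw [norm_smul, norm_mul, Real.norm_of_nonneg (by positivity : 0 ≤ N⁻¹), RCLike.norm_natCast]
      gcongr
      calc N⁻¹ * ((sharedWindows N z).card : ℝ) ≤ N⁻¹ * (2 * N) := by
            gcongr
            exact (card_sharedWindows_le (by linarith) z).trans (by linarith)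
        _ = 2 := by field_simp
    · simpa using (tendsto_inv_mul_card_sharedWindows z).smul_const (g z)
  refine hlim.congr' ?_
  filter_upwards [eventually_ge_atTop 0] with N hN
  simp only [(hasSum_setIntegral_window_prod hg hN).tsum_eq, mul_smul, integral_smul]

variable {𝕜 : Type*} [RCLike 𝕜]

theorem integral_prod_mul_conj {α : Type*} [MeasurableSpace α] {μ : Measure α} [SFinite μ]
    (f : α → 𝕜) :
    ∫ z, f z.1 * conj (f z.2) ∂μ.prod μ = ((‖∫ x, f x ∂μ‖ ^ 2 : ℝ) : 𝕜) := by
  rw [integral_prod_mul f fun x => conj (f x), integral_conj, RCLike.mul_conj, RCLike.ofReal_pow]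

theorem tendsto_inv_mul_tsum_norm_setIntegral_window_sq {ψ : ℝ → 𝕜} (hψ : Integrable ψ) :
    Tendsto (fun N : ℝ => N⁻¹ * ∑' k : ℤ, ‖∫ x in window N k, ψ x‖ ^ 2) atTop
      (𝓝 (‖∫ x, ψ x‖ ^ 2)) := by
  have hg : Integrable fun z : ℝ × ℝ => ψ z.1 * conj (ψ z.2) :=
    hψ.mul_prod (RCLike.conjCLE.integrable_comp_iff.2 hψ)
  have hlim := tendsto_inv_smul_tsum_setIntegral_window_prod hg
  simp only [Measure.volume_eq_prod, ← Measure.prod_restrict, integral_prod_mul_conj,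
    ← RCLike.ofReal_tsum, RCLike.real_smul_eq_coe_mul, ← RCLike.ofReal_mul] at hlim
  simpa only [Function.comp_def, RCLike.ofReal_re] using (RCLike.continuous_re.tendsto _).comp hlim

end Windows

section Translates

variable {𝕜 ι : Type*} [RCLike 𝕜] {ψ : ι → ℝ → 𝕜} {N : ℝ}

/-- Orthonormality in `L²(ℝ)` of the integer translates `ψ_a(x - k)` of a family of functions,
stated through integrals so that no membership in `L²(ℝ)` is presupposed. -/
def HasOrthonormalTranslates [DecidableEq ι] (ψ : ι → ℝ → 𝕜) : Prop :=
  ∀ (a b : ι) (j k : ℤ),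
    ∫ x : ℝ, ψ a (x - j) * star (ψ b (x - k)) = if a = b ∧ j = k then 1 else 0

/-- The closed linear span in `L²(ℝ)` of the functions `ψ_a(N x - k)`, `k ∈ ℤ`. -/
noncomputable def dilateSpace (ψ : ι → ℝ → 𝕜) (N : ℝ) :
    Submodule 𝕜 (Lp 𝕜 2 (volume : Measure ℝ)) :=
  (Submodule.span 𝕜 {f : Lp 𝕜 2 (volume : Measure ℝ) |
    ∃ e : ι × ℤ, f =ᵐ[volume] fun x => ψ e.1 (N * x - e.2)}).topologicalClosure

theorem memLp_two_of_integral_mul_star_ne_zero {α : Type*} [MeasurableSpace α] {μ : Measure α}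
    {f : α → 𝕜} (hf : AEStronglyMeasurable f μ) (h : ∫ x, f x * star (f x) ∂μ ≠ 0) :
    MemLp f 2 μ := by
  refine (memLp_two_iff_integrable_sq_norm hf).2 ?_
  simpa only [norm_mul, norm_star, ← sq] using (Integrable.of_integral_ne_zero h).norm

theorem HasOrthonormalTranslates.memLp_two [DecidableEq ι] (ho : HasOrthonormalTranslates ψ)
    {a : ι} (ha : AEStronglyMeasurable (ψ a)) : MemLp (ψ a) 2 :=
  memLp_two_of_integral_mul_star_ne_zero ha (by simpa using (ho a a 0 0).trans_ne (by simp))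

theorem memLp_two_comp_mul_sub {f : ℝ → 𝕜} (hf : MemLp f 2) (hN : N ≠ 0) (c : ℝ) :
    MemLp (fun x => f (N * x - c)) 2 := by
  have hf' := hf.comp_measurePreserving (measurePreserving_sub_right volume c)
  have hmeas : AEStronglyMeasurable (fun x => f (N * x - c)) :=
    hf'.1.comp_quasiMeasurePreserving (Measure.quasiMeasurePreserving_smul volume hN)
  rw [memLp_two_iff_integrable_sq_norm hmeas]
  exact hf'.integrable_norm_pow two_ne_zero |>.comp_mul_left' hN

/-- The `L²`-normalized function `√N ψ_a(N x - k)` as an element of `L²(ℝ)`. -/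
noncomputable def dilatedTranslate (hψ : ∀ a, MemLp (ψ a) 2) (hN : 0 < N) (e : ι × ℤ) :
    Lp 𝕜 2 (volume : Measure ℝ) :=
  ((√N : ℝ) : 𝕜) • (memLp_two_comp_mul_sub (hψ e.1) hN.ne' e.2).toLp _

theorem coeFn_dilatedTranslate (hψ : ∀ a, MemLp (ψ a) 2) (hN : 0 < N) (e : ι × ℤ) :
    dilatedTranslate hψ hN e =ᵐ[volume] fun x => ((√N : ℝ) : 𝕜) * ψ e.1 (N * x - e.2) := by
  have hmem := memLp_two_comp_mul_sub (hψ e.1) hN.ne' e.2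
  filter_upwards [Lp.coeFn_smul ((√N : ℝ) : 𝕜) (hmem.toLp _), hmem.coeFn_toLp] with x h₁ h₂
  rw [dilatedTranslate, h₁, Pi.smul_apply, h₂, smul_eq_mul]

theorem topologicalClosure_span_dilatedTranslate (hψ : ∀ a, MemLp (ψ a) 2) (hN : 0 < N) :
    (Submodule.span 𝕜 (Set.range (dilatedTranslate hψ hN))).topologicalClosure
      = dilateSpace ψ N := by
  have hunit : IsUnit ((√N : ℝ) : 𝕜) :=
    (RCLike.ofReal_ne_zero.2 (Real.sqrt_pos.2 hN).ne').isUnit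
  unfold dilatedTranslate
  rw [Set.range_smul, Submodule.span_smul_eq_of_isUnit _ _ hunit, dilateSpace]
  congr 2
  ext f
  refine exists_congr fun e => ⟨?_, fun h => ?_⟩
  · rintro rfl
    exact MemLp.coeFn_toLp _
  · exact Lp.ext ((MemLp.coeFn_toLp _).trans h.symm)

theorem HasOrthonormalTranslates.orthonormal_dilatedTranslate [DecidableEq ι]
    (ho : HasOrthonormalTranslates ψ) (hψ : ∀ a, MemLp (ψ a) 2) (hN : 0 < N) :
    Orthonormal 𝕜 (dilatedTranslate hψ hN) := by
  rw [orthonormal_iff_ite]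
  rintro ⟨a, j⟩ ⟨b, k⟩
  let G (y : ℝ) : 𝕜 := ψ b (y - k) * star (ψ a (y - j))
  have hsq : ((√N : ℝ) : 𝕜) * ((√N : ℝ) : 𝕜) = N := by
    rw [← RCLike.ofReal_mul, Real.mul_self_sqrt hN.le]
  calc inner 𝕜 (dilatedTranslate hψ hN (a, j)) (dilatedTranslate hψ hN (b, k))
      = ∫ x, (N : 𝕜) * G (N * x) := by
        rw [L2.inner_def]
        refine integral_congr_ae ?_
        filter_upwards [coeFn_dilatedTranslate hψ hN (a, j), coeFn_dilatedTranslate hψ hN (b, k)]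
          with x h₁ h₂
        simp only [G, h₁, h₂, RCLike.inner_apply, map_mul, RCLike.conj_ofReal, RCLike.star_def,
          ← hsq]
        ring
    _ = ∫ y, G y := by
        rw [integral_const_mul, Measure.integral_comp_mul_left, abs_of_pos (inv_pos.2 hN),
          RCLike.real_smul_eq_coe_mul, RCLike.ofReal_inv,
          mul_inv_cancel_left₀ (RCLike.ofReal_ne_zero.2 hN.ne')]
    _ = if (a, j) = (b, k) then 1 else 0 := by
        rw [ho]
        simp only [Prod.mk.injEq, eq_comm]

theorem norm_inner_dilatedTranslate_indicatorConstLp_sq (hψ : ∀ a, MemLp (ψ a) 2) (hN : 0 < N)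
    (hμ : volume (Set.Ioc (0 : ℝ) 1) ≠ ⊤) (e : ι × ℤ) :
    ‖inner 𝕜 (dilatedTranslate hψ hN e)
        (indicatorConstLp 2 measurableSet_Ioc hμ (1 : 𝕜))‖ ^ 2
      = N⁻¹ * ‖∫ x in window N e.2, ψ e.1 x‖ ^ 2 := by
  have hwin : ∫ x in Set.Ioc (0 : ℝ) 1, ψ e.1 (N * x - e.2)
      = N⁻¹ • ∫ x in window N e.2, ψ e.1 x := by
    rw [window, ← intervalIntegral.integral_of_le zero_le_one,
      intervalIntegral.integral_comp_mul_sub _ hN.ne', mul_zero, mul_one, zero_sub,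
      intervalIntegral.integral_of_le (by linarith)]
  rw [norm_inner_symm, L2.inner_indicatorConstLp_one,
    integral_congr_ae (ae_restrict_of_ae (coeFn_dilatedTranslate hψ hN e)), integral_const_mul,
    hwin, norm_mul, norm_smul, RCLike.norm_ofReal, mul_pow, mul_pow, sq_abs, Real.sq_sqrt hN.le,
    Real.norm_of_nonneg (inv_nonneg.2 hN.le)]
  field_simp

theorem HasOrthonormalTranslates.tsum_norm_inner_dilatedTranslate_sq [Fintype ι] [DecidableEq ι]
    (ho : HasOrthonormalTranslates ψ) (hψ : ∀ a, MemLp (ψ a) 2) (hN : 0 < N)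
    (hμ : volume (Set.Ioc (0 : ℝ) 1) ≠ ⊤) :
    ∑' e, ‖inner 𝕜 (dilatedTranslate hψ hN e)
        (indicatorConstLp 2 measurableSet_Ioc hμ (1 : 𝕜))‖ ^ 2
      = ∑ a, N⁻¹ * ∑' k : ℤ, ‖∫ x in window N k, ψ a x‖ ^ 2 := by
  rw [((ho.orthonormal_dilatedTranslate hψ hN).inner_products_summable _).tsum_prod, tsum_fintype]
  simp only [norm_inner_dilatedTranslate_indicatorConstLp_sq, tsum_mul_left]

theorem HasOrthonormalTranslates.sum_norm_integral_sq_eq_one [Fintype ι] [DecidableEq ι]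
    {κ : Type*} [Preorder κ] [(atTop : Filter κ).NeBot] {s : κ → ℝ}
    (ho : HasOrthonormalTranslates ψ) (hψ : ∀ a, Integrable (ψ a))
    (hpos : ∀ n, 0 < s n) (hs : Tendsto s atTop atTop)
    (hmono : Monotone fun n => dilateSpace ψ (s n))
    (hdense : ⊤ ≤ (⨆ n, dilateSpace ψ (s n)).topologicalClosure) :
    ∑ a, ‖∫ x, ψ a x‖ ^ 2 = 1 := by
  have hψ₂ (a : ι) : MemLp (ψ a) 2 := ho.memLp_two (hψ a).aestronglyMeasurable
  have hμ : volume (Set.Ioc (0 : ℝ) 1) ≠ ⊤ := measure_Ioc_lt_top.ne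
  have hparseval := tendsto_tsum_norm_inner_sq
    (fun n => ho.orthonormal_dilatedTranslate hψ₂ (hpos n))
    (by simpa only [topologicalClosure_span_dilatedTranslate] using hmono)
    (by simpa only [topologicalClosure_span_dilatedTranslate] using hdense)
    (indicatorConstLp 2 measurableSet_Ioc hμ (1 : 𝕜))
  simp only [ho.tsum_norm_inner_dilatedTranslate_sq hψ₂] at hparseval
  have hwindows := tendsto_finsetSum Finset.univ fun a _ =>
    (tendsto_inv_mul_tsum_norm_setIntegral_window_sq (hψ a)).comp hs
  rw [tendsto_nhds_unique hwindows hparseval,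
    norm_indicatorConstLp two_ne_zero ENNReal.ofNat_ne_top]
  simp

end Translates

section TwoDirectional

variable {𝕜 : Type*} [RCLike 𝕜] {r : ℕ} {φ : ℝ → Fin r → 𝕜}

/-- The components of `φ(x)` and of `φ(-x)` as one family of `2r` scalar functions: the integer
translates of this family are the functions `φ_i(x - k)` and `φ_i(k - x)`. -/
def twoSided (φ : ℝ → Fin r → 𝕜) : Fin r ⊕ Fin r → ℝ → 𝕜
  | Sum.inl i => fun x => φ x i
  | Sum.inr i => fun x => φ (-x) i

theorem scalingSpace_eq_dilateSpace (d : ℕ) (φ : ℝ → Fin r → 𝕜) (n : ℤ) :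
    scalingSpace d φ n = dilateSpace (twoSided φ) ((d : ℝ) ^ n) := by
  rw [scalingSpace, dilateSpace]
  congr 2
  ext f
  simp [dilates, twoSided, Prod.exists, Sum.exists, exists_comm (α := ℤ)]

theorem integrable_twoSided (hφ : Integrable φ) (a : Fin r ⊕ Fin r) :
    Integrable (twoSided φ a) := by
  rcases a with i | i
  · exact hφ.eval i
  · exact (hφ.eval i).comp_neg

theorem IsOrthogonal.hasOrthonormalTranslates_twoSided (h : IsOrthogonal φ) :
    HasOrthonormalTranslates (twoSided φ) := by
  have hsame (i l : Fin r) (j k : ℤ) : ∫ x : ℝ, φ (x - j) i * star (φ (x - k) l)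
      = if i = l ∧ j = k then 1 else 0 := by
    refine (congrFun₂ (h.same j k) i l).trans ?_
    by_cases hjk : j = k <;> simp [hjk, Matrix.one_apply]
  have hcross (i l : Fin r) (j k : ℤ) : ∫ x : ℝ, φ (x - j) i * star (φ (k - x) l) = 0 :=
    congrFun₂ (h.cross j k) i l
  rintro (i | i) (l | l) j k <;> simp only [twoSided, neg_sub]
  · simpa using hsame i l j k
  · simpa using hcross i l j k
  · have hconj := congrArg star (hcross l i k j)
    rw [RCLike.star_def, ← integral_conj] at hconj
    simpa [mul_comm] using hconj
  · rw [← integral_neg_eq_self]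
    simpa [add_comm] using hsame i l (-j) (-k)

theorem sum_norm_integral_twoSided_sq (φ : ℝ → Fin r → 𝕜) :
    ((∑ a, ‖∫ x, twoSided φ a x‖ ^ 2 : ℝ) : 𝕜) = 2 * (star (moment φ 0) ⬝ᵥ moment φ 0) := by
  have hneg (i : Fin r) : ∫ x, φ (-x) i = ∫ x, φ x i := integral_neg_eq_self (φ · i) volume
  simp [twoSided, hneg, moment, dotProduct, RCLike.conj_mul, two_mul]

end TwoDirectional

theorem tendsto_zpow_int_atTop {d : ℝ} (hd : 1 < d) :
    Tendsto (fun n : ℤ => d ^ n) atTop atTop := by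
  refine tendsto_atTop_atTop_of_monotone (zpow_right_strictMono₀ hd).monotone fun b => ?_
  obtain ⟨n, hn⟩ := pow_unbounded_of_one_lt b hd
  exact ⟨n, by simpa using hn.le⟩

end TwoDirection

open TwoDirection in
theorem theorem3p3_general {𝕜 : Type*} [RCLike 𝕜] {d r : ℕ} (hd : 2 ≤ d) (φ : ℝ → Fin r → 𝕜)
    (hmono : Monotone (scalingSpace d φ))
    (hdense : Dense (⋃ n, (scalingSpace d φ n : Set (Lp 𝕜 2 (volume : Measure ℝ)))))
    (horth : IsOrthogonal φ) (hint : Integrable φ) :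
    star (moment φ 0) ⬝ᵥ moment φ 0 = 1 / 2 := by
  have hd₁ : (1 : ℝ) < d := by exact_mod_cast hd
  have hsup : ⊤ ≤ (⨆ n, scalingSpace d φ n).topologicalClosure := fun f _ =>
    closure_mono (Set.iUnion_subset fun n => le_iSup (scalingSpace d φ) n) (hdense f)
  simp only [funext (scalingSpace_eq_dilateSpace d φ)] at hmono hsup
  have hone := horth.hasOrthonormalTranslates_twoSided.sum_norm_integral_sq_eq_one
    (integrable_twoSided hint) (fun n => zpow_pos (by positivity) n)
    (tendsto_zpow_int_atTop hd₁) hmono hsup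
  have htwo := sum_norm_integral_twoSided_sq φ
  rw [hone, RCLike.ofReal_one] at htwo
  exact eq_one_div_of_mul_eq_one_right htwo.symm

theorem theorem3p3 {𝕜 : Type*} [RCLike 𝕜] {d r : ℕ}
    (Pp Pm : ℤ → Matrix (Fin r) (Fin r) ℝ) (φ : ℝ → Fin r → 𝕜)
    (hφ : TwoDirection.IsMultiscaling d Pp Pm φ)
    (horth : TwoDirection.IsOrthogonal φ)
    (hsupp : HasCompactSupport φ)
    (hcont : Continuous φ)
    (hE : TwoDirection.ConditionE
      ((TwoDirection.symbolAtOne d Pp Pm).map (algebraMap ℝ ℂ))) :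
    star (TwoDirection.moment φ 0) ⬝ᵥ TwoDirection.moment φ 0 = 1 / 2 :=
  theorem3p3_general hφ.two_le φ (monotone_int_of_le_succ hφ.multiresolution.nested)
    hφ.multiresolution.dense horth (hcont.integrable_of_hasCompactSupport hsupp)
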